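/- Let $\Pi$ be a finite nonempty set of policies, $\mathcal O$ a measurable space, and $\mathcal M$ a finite set of models. A model $M$ assigns to each $\pi\in\Pi$ a probability measure $M(\cdot|\pi)$ on $\mathcal O$ and a value $V_M(\pi)\in[0,1]$; mixtures of models mix both the laws and the values, and $\mathrm{co}(\mathcal N)$ is the set of finite mixtures of elements of $\mathcal N$. Write $\Delta(S)$ for the probability distributions on a finite set $S$, and $V_M(\pi_M)=\max_{\pi\in\Pi}V_M(\pi)$. For $\eta>0$ and a class $\mathcal N$ of models put $$\mathsf{DEC}^{\mathrm{KL}}_\eta(\mathcal N)=\sup_{\bar M\in\mathrm{co}(\mathcal N)}\ \inf_{p\in\Delta(\Pi)}\ \sup_{M\in\mathcal N}\ \mathbb E_{\pi\sim p}\Big[V_M(\pi_M)-V_M(\pi)-\tfrac1\eta\,\mathrm{KL}\big(M(\cdot|\pi),\bar M(\cdot|\pi)\big)\Big].$$ For a finite collection $\Phi$ of disjoint subsets of $\mathcal M\times\Pi$ with union $\Psi$, and for $\rho\in\Delta(\Phi)$, $\nu\in\Delta(\Psi)$, $p\in\Delta(\Pi)$, put $$\mathsf{AIR}^\Phi_{\rho,\eta}(p,\nu)=\mathbb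 E_{\pi\sim p}\,\mathbb E_{(M,\pi^\star)\sim\nu}\,\mathbb E_{o\sim M(\cdot|\pi)}\Big[V_M(\pi^\star)-V_M(\pi)-\tfrac1\eta\,\mathrm{KL}\big(\nu_{\phi}(\cdot|\pi,o),\rho\big)\Big],$$ where $\nu_\phi(\cdot|\pi,o)$ is the posterior distribution on $\Phi$, $$\nu(\phi|\pi,o)=\frac{\sum_{(M,\pi^\star)\in\phi}\nu(M,\pi^\star)M(o|\pi)}{\sum_{\phi'\in\Phi}\sum_{(M,\pi^\star)\in\phi'}\nu(M,\pi^\star)M(o|\pi)},$$ and $M(o|\pi)$ is the density of $M(\cdot|\pi)$ with respect to a common dominating measure. Let $$\bar{\mathcal M}(\Phi)=\bigcup_{\phi\in\Phi}\mathrm{co}\big(\{M\in\mathcal M:\exists\,\pi,\ (M,\pi)\in\phi\}\big).$$ All quantities are extended real numbers, and outcomes of probability zero do not contribute to an expectation. Suppose that $\Phi=\Theta\times\Pi$ for a partition $\Theta$ of $\mathcal M$, that is, $\Phi=\{\theta\times\{\pi\}:\theta\in\Theta,\ \pi\in\Pi\}$. Then for every $\eta>0$ $$\sup_{\rho\in\Delta(\Phi)}\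 \sup_{\nu\in\Delta(\Psi)}\ \inf_{p\in\Delta(\Pi)}\ \mathsf{AIR}^\Phi_{\rho,\eta}(p,\nu)=\mathsf{DEC}^{\mathrm{KL}}_\eta\big(\bar{\mathcal M}(\Phi)\big).$$ -/

import Mathlib

open MeasureTheory InformationTheory
open scoped NNReal ENNReal

noncomputable section

namespace DecisionMaking

/-- A model: for every policy `π` a probability law `M(· | π)` on the observation space `O`,
together with a value function with values in `[0, 1]`. -/
structure Model (P O : Type*) [MeasurableSpace O] where
  law : P → ProbabilityMeasure O
  value : P → ℝ
  value_mem : ∀ π, value π ∈ Set.Icc (0 : ℝ) 1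

/-- `Δ(s)` for a finite set `s`: probability weights that vanish outside `s`. -/
def simplex {α : Type*} (s : Finset α) : Set (α → ℝ≥0) :=
  {w | (∀ a, a ∉ s → w a = 0) ∧ ∑ a ∈ s, w a = 1}

/-- The measure with weights `w` on the finite set `s`, on the discrete σ-algebra. -/
def weightMeasure {α : Type*} (s : Finset α) (w : α → ℝ≥0∞) : @Measure α ⊤ :=
  ∑ a ∈ s, w a • @Measure.dirac α ⊤ a

/-- The Kullback-Leibler divergence of two distributions on a finite set `s`. -/
def finKL {α : Type*} (s : Finset α) (q r : α → ℝ≥0∞) : ℝ≥0∞ :=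
  @klDiv α ⊤ (weightMeasure s q) (weightMeasure s r)

section

variable {P O : Type*} [MeasurableSpace O]

/-- The convex hull `co(S)` of a class of models: all finite mixtures of elements of `S`.
Both the observation laws and the value functions are mixed. -/
def co (S : Set (Model P O)) : Set (Model P O) :=
  {N | ∃ (t : Finset (Model P O)) (w : Model P O → ℝ≥0), (t : Set (Model P O)) ⊆ S ∧
    ∑ M ∈ t, w M = 1 ∧
    (∀ π, (N.law π : Measure O) = ∑ M ∈ t, w M • (M.law π : Measure O)) ∧
    ∀ π, N.value π = ∑ M ∈ t, (w M : ℝ) * M.value π}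

/-- The offset DEC with KL divergence of a class of models. Here `⨆ π', M.value π'` is
`V_M(π_M)`, the largest value of `M`. The value is an extended real number, and `0 * ⊥ = 0`
in `EReal`, so that policies of probability zero do not contribute to expectations. -/
def DEC [Fintype P] (η : ℝ) (S : Set (Model P O)) : EReal :=
  ⨆ Mbar ∈ co S, ⨅ p ∈ simplex (Finset.univ : Finset P), ⨆ M ∈ S,
    ∑ π : P, ((p π : ℝ) : EReal) *
      ((((⨆ π', M.value π') - M.value π : ℝ) : EReal) -
        ((1 / η : ℝ) : EReal) *
          (klDiv (M.law π : Measure O) (Mbar.law π : Measure O) : EReal))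

open Classical in
/-- `Ψ`, the union of all elements of `Φ`. -/
def support (Φ : Finset (Finset (Model P O × P))) : Finset (Model P O × P) :=
  Φ.biUnion id

/-- The density `M(o | π)` with respect to a measure that dominates all observation laws
`M(· | π)` that occur in `Φ`, namely their sum. -/
def density (Φ : Finset (Finset (Model P O × P))) (M : Model P O) (π : P) (o : O) : ℝ≥0∞ :=
  (M.law π : Measure O).rnDeriv (∑ x ∈ support Φ, (x.1.law π : Measure O)) o

/-- The posterior `ν(φ | π, o)` over `Φ`, given by Bayes' rule. -/
def posterior (Φ : Finset (Finset (Model P O × P))) (ν : Model P O × P → ℝ≥0)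
    (π : P) (o : O) (φ : Finset (Model P O × P)) : ℝ≥0∞ :=
  (∑ x ∈ φ, (ν x : ℝ≥0∞) * density Φ x.1 π o) /
    ∑ φ' ∈ Φ, ∑ x ∈ φ', (ν x : ℝ≥0∞) * density Φ x.1 π o

/-- `AIR^Φ_{ρ,η}(p, ν)`. The expectation over `o ∼ M(· | π)` is taken of the KL divergence, the
only term that depends on `o`; this is a non-negative function with values in `[0, ∞]`. -/
def AIR [Fintype P] (Φ : Finset (Finset (Model P O × P)))
    (ρ : Finset (Model P O × P) → ℝ≥0) (η : ℝ) (p : P → ℝ≥0)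
    (ν : Model P O × P → ℝ≥0) : EReal :=
  ∑ π : P, ((p π : ℝ) : EReal) * ∑ x ∈ support Φ, ((ν x : ℝ) : EReal) *
    (((x.1.value x.2 - x.1.value π : ℝ) : EReal) -
      ((1 / η : ℝ) : EReal) *
        ((∫⁻ o, finKL Φ (posterior Φ ν π o) (fun φ => (ρ φ : ℝ≥0∞))
          ∂(x.1.law π : Measure O) : ℝ≥0∞) : EReal))

/-- The max-min value of `AIR^Φ`, over `ρ ∈ Δ(Φ)`, `ν ∈ Δ(Ψ)` and `p ∈ Δ(Π)`. -/
def maxMinAIR [Fintype P] (η : ℝ) (Φ : Finset (Finset (Model P O × P))) : EReal :=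
  ⨆ ρ ∈ simplex Φ, ⨆ ν ∈ simplex (support Φ),
    ⨅ p ∈ simplex (Finset.univ : Finset P), AIR Φ ρ η p ν

/-- The `Φ`-aware convexification of the model class `ℳ`. -/
def convexification (ℳ : Finset (Model P O)) (Φ : Finset (Finset (Model P O × P))) :
    Set (Model P O) :=
  ⋃ φ ∈ Φ, co {M | M ∈ ℳ ∧ ∃ π, (M, π) ∈ φ}

open Classical in
/-- `Θ × Π`: the collection of all sets `{(M, π) | M ∈ θ}` with `θ ∈ Θ` and `π ∈ Π`. -/
def prodPolicies [Fintype P] (Θ : Finset (Finset (Model P O))) :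
    Finset (Finset (Model P O × P)) :=
  (Θ ×ˢ (Finset.univ : Finset P)).image fun y => y.1 ×ˢ {y.2}

end

end DecisionMaking

end

open MeasureTheory InformationTheory
open scoped NNReal ENNReal

noncomputable section

namespace DecisionMaking

/-! Write κ_φ for the part of the ν-mixture of the observation laws coming from φ, n_φ = ν(φ) for
its mass, and M̄ for the whole mixture. By Bayes' rule the expected divergence of the posterior from
ρ equals ∑_φ KL(κ_φ, ρ_φ M̄), with KL for unnormalised measures (`sum_lintegral_finKL_posterior`).

For the upper bound, replacing ρ_φ by n_φ only lowers each term (`klDiv_mass_smul_le`), and the sum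
becomes ∑_φ n_φ KL(N_φ, M̄), where N_φ is the mixture conditioned on φ. Since φ = θ × {π₀}, N_φ lies
in the convexification and its comparator value is N_φ(π₀), at most its maximum. So AIR is at most
the n-average of the DEC objective at the N_φ, for the same p and M̄.

For the lower bound, fix M̄ and a finite mixture α of models M_i of the convexification. As Φ is a
full product, each M_i can be carried by a block whose policy is optimal for M_i. With ν the
resulting prior and ρ its marginal, AIR is at least the α-average of the DEC objective at M̄: the
mixture is the closest reference (`sum_klDiv_mixture_le`), and KL is jointly subadditive within
blocks (`klDiv_sum_le`). Hence every α admits a good p. Convex separation (`exists_simplex_sum_le`)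
exchanges the quantifiers and gives one p for all models at finite divergence; a small uniform
admixture sends the others to -∞. -/

/-! ### Kullback-Leibler divergence through densities. -/

/-- The integrand `b * klFun (a / b)` of the Kullback-Leibler divergence of two measures with
densities `a` and `b`. -/
def klTerm (a b : ℝ≥0∞) : ℝ≥0∞ :=
  if b = 0 then a * ∞ else b * ENNReal.ofReal (klFun (a / b).toReal)

lemma measurable_klTerm {α : Type*} [MeasurableSpace α] {a b : α → ℝ≥0∞} (ha : Measurable a)
    (hb : Measurable b) : Measurable fun x => klTerm (a x) (b x) := by
  unfold klTerm
  refine Measurable.ite (hb (measurableSet_singleton 0)) (ha.mul_const _) ?_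
  exact hb.mul (measurable_klFun.comp (ha.div hb).ennreal_toReal).ennreal_ofReal

lemma mul_klTerm {c a b : ℝ≥0∞} (hc0 : c ≠ 0) (hc : c ≠ ∞) :
    c * klTerm a b = klTerm (c * a) (c * b) := by
  unfold klTerm
  by_cases hb : b = 0
  · simp [hb, mul_assoc]
  · rw [if_neg hb, if_neg (mul_ne_zero hc0 hb), ENNReal.mul_div_mul_left _ _ hc0 hc, mul_assoc]

/-- The divergence term in real arithmetic, when it is finite. -/
lemma klTerm_coe {a b : ℝ≥0} (h : b = 0 → a = 0) :
    klTerm a b = ENNReal.ofReal (a * Real.log (a / b) + b - a) := by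
  unfold klTerm
  by_cases hb : b = 0
  · simp [hb, h hb]
  · have hb' : (b : ℝ) ≠ 0 := by exact_mod_cast hb
    rw [if_neg (by exact_mod_cast hb), ← ENNReal.coe_div hb, ENNReal.coe_toReal,
      ← ENNReal.ofReal_coe_nnreal (p := b), ← ENNReal.ofReal_mul b.coe_nonneg, klFun_apply,
      NNReal.coe_div]
    congr 1
    field_simp

lemma klTerm_coe_zero {a : ℝ≥0} (h : a ≠ 0) : klTerm a 0 = ∞ := by
  simp [klTerm, h]

/-- This is `b * klFun (a / b) ≥ 0` with the denominator cleared; the log sum, mixture and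
mass-scaling inequalities all reduce to it. -/
lemma klTerm_real_nonneg {a b : ℝ} (ha : 0 ≤ a) (hb : 0 ≤ b) (h : b = 0 → a = 0) :
    0 ≤ a * Real.log (a / b) + b - a := by
  by_cases hb' : b = 0
  · simp [hb', h hb']
  · have h1 := mul_nonneg hb (klFun_nonneg (div_nonneg ha hb))
    rw [klFun_apply] at h1
    field_simp at h1
    linarith

/-- Divergence of two measures given by densities. -/
lemma klDiv_withDensity {α : Type*} [MeasurableSpace α] (l : Measure α) {a b : α → ℝ≥0∞}
    (ha : Measurable a) (hb : Measurable b) (ha' : ∫⁻ x, a x ∂l ≠ ∞) (hb' : ∫⁻ x, b x ∂l ≠ ∞) :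
    klDiv (l.withDensity a) (l.withDensity b) = ∫⁻ x, klTerm (a x) (b x) ∂l := by
  have : IsFiniteMeasure (l.withDensity a) := isFiniteMeasure_withDensity ha'
  have : IsFiniteMeasure (l.withDensity b) := isFiniteMeasure_withDensity hb'
  have hbfin : ∀ᵐ x ∂l, b x < ∞ := ae_lt_top hb hb'
  by_cases hac : l.withDensity a ≪ l.withDensity b
  · have hZ : MeasurableSet {x | b x = 0} := hb (measurableSet_singleton 0)
    have hab : ∀ᵐ x ∂l, b x = 0 → a x = 0 := by
      have h1 : l.withDensity b {x | b x = 0} = 0 := by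
        rw [withDensity_apply _ hZ, setLIntegral_congr_fun hZ (g := fun _ => 0) (fun x hx => hx)]
        simp
      have h2 := hac h1
      rw [withDensity_apply _ hZ, lintegral_eq_zero_iff ha] at h2
      exact (ae_restrict_iff' hZ).1 h2
    have hrep : l.withDensity a = (l.withDensity b).withDensity (fun x => a x / b x) := by
      refine .trans ?_ (withDensity_mul _ hb (ha.div hb))
      refine withDensity_congr_ae ?_
      filter_upwards [hab, hbfin] with x hx hx'
      by_cases h0 : b x = 0
      · simp [h0, hx h0]
      · simp [ENNReal.mul_div_cancel h0 hx'.ne]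
    have hrn : (l.withDensity a).rnDeriv (l.withDensity b) =ᵐ[l.withDensity b]
        fun x => a x / b x := by
      conv_lhs => rw [hrep]
      exact Measure.rnDeriv_withDensity _ (ha.div hb)
    rw [klDiv_eq_lintegral_klFun_of_ac hac]
    rw [lintegral_congr_ae (g := fun x => ENNReal.ofReal (klFun (a x / b x).toReal))
      (by filter_upwards [hrn] with x hx; rw [hx])]
    refine (lintegral_withDensity_eq_lintegral_mul _ hb
      (measurable_klFun.comp (ha.div hb).ennreal_toReal).ennreal_ofReal).trans ?_
    refine lintegral_congr_ae ?_
    filter_upwards [hab] with x hx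
    unfold klTerm
    by_cases h0 : b x = 0
    · simp [h0, hx h0]
    · simp [h0]
  · rw [klDiv_of_not_ac hac]
    symm
    -- Without absolute continuity both sides are infinite: some set is null for `b` but not for
    -- `a`, and there the integrand is `a * ∞`.
    obtain ⟨s, hs, hsb, hsa⟩ : ∃ s, MeasurableSet s ∧ l.withDensity b s = 0 ∧
        l.withDensity a s ≠ 0 := by
      by_contra! h
      exact hac (Measure.AbsolutelyContinuous.mk h)
    rw [withDensity_apply _ hs, lintegral_eq_zero_iff hb] at hsb
    rw [withDensity_apply _ hs] at hsa
    rw [← top_le_iff]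
    calc ∞ = (∫⁻ x in s, a x ∂l) * ∞ := by rw [ENNReal.mul_top hsa]
      _ = ∫⁻ x in s, a x * ∞ ∂l := (lintegral_mul_const _ ha).symm
      _ = ∫⁻ x in s, klTerm (a x) (b x) ∂l := by
          refine lintegral_congr_ae ?_
          filter_upwards [hsb] with x hx
          simp only [Pi.zero_apply] at hx
          simp [klTerm, hx]
      _ ≤ _ := setLIntegral_le_lintegral _ _

/-- A finite measure has a finite density with respect to any dominating measure. -/
lemma exists_nnreal_density {α : Type*} [MeasurableSpace α] {μ l : Measure α}
    [IsFiniteMeasure μ] [SigmaFinite l] (h : μ ≪ l) :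
    ∃ g : α → ℝ≥0, Measurable g ∧ l.withDensity (fun x => (g x : ℝ≥0∞)) = μ := by
  refine ⟨fun x => (μ.rnDeriv l x).toNNReal, (Measure.measurable_rnDeriv _ _).ennreal_toNNReal, ?_⟩
  conv_rhs => rw [← Measure.withDensity_rnDeriv_eq μ l h]
  refine withDensity_congr_ae ?_
  filter_upwards [Measure.rnDeriv_ne_top μ l] with x hx
  exact ENNReal.coe_toNNReal hx

lemma sum_withDensity {α ι : Type*} [MeasurableSpace α] (l : Measure α) (s : Finset ι)
    {f : ι → α → ℝ≥0∞} (hf : ∀ i ∈ s, Measurable (f i)) :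
    ∑ i ∈ s, l.withDensity (f i) = l.withDensity (fun x => ∑ i ∈ s, f i x) := by
  refine Measure.ext fun t ht => ?_
  rw [withDensity_apply _ ht, lintegral_finsetSum _ hf, Measure.finsetSum_apply]
  exact Finset.sum_congr rfl fun i _ => withDensity_apply _ ht

/-- Counting measure on `s` serves as the common reference, so that `finKL` becomes an instance of
`klDiv_withDensity`. -/
lemma weightMeasure_eq_withDensity {α : Type*} (s : Finset α) (w : α → ℝ≥0∞) :
    weightMeasure s w = @Measure.withDensity α ⊤ (weightMeasure s 1) w := by
  let _ : MeasurableSpace α := ⊤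
  refine Measure.ext fun t ht => ?_
  rw [withDensity_apply _ ht, ← lintegral_indicator ht]
  simp only [weightMeasure, Pi.one_apply, one_smul, lintegral_finsetSum_measure,
    Measure.finsetSum_apply, Measure.smul_apply, smul_eq_mul]
  refine Finset.sum_congr rfl fun a _ => ?_
  rw [Measure.dirac_apply' _ ht, lintegral_dirac' _ measurable_from_top]
  by_cases h : a ∈ t <;> simp [h]

lemma lintegral_weightMeasure_one {α : Type*} (s : Finset α) (w : α → ℝ≥0∞) :
    @lintegral α ⊤ (weightMeasure s 1) w = ∑ a ∈ s, w a := by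
  let _ : MeasurableSpace α := ⊤
  simp only [weightMeasure, Pi.one_apply, one_smul, lintegral_finsetSum_measure]
  exact Finset.sum_congr rfl fun a _ => lintegral_dirac' _ measurable_from_top

lemma finKL_eq_sum {α : Type*} {s : Finset α} {q r : α → ℝ≥0∞} (hq : ∀ a ∈ s, q a ≠ ∞)
    (hr : ∀ a ∈ s, r a ≠ ∞) : finKL s q r = ∑ a ∈ s, klTerm (q a) (r a) := by
  let _ : MeasurableSpace α := ⊤
  rw [finKL, weightMeasure_eq_withDensity s q, weightMeasure_eq_withDensity s r,
    klDiv_withDensity _ measurable_from_top measurable_from_top, lintegral_weightMeasure_one]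
  · rw [lintegral_weightMeasure_one]; simpa using hq
  · rw [lintegral_weightMeasure_one]; simpa using hr

/-! ### Pointwise inequalities for finite sums. -/

/-- The log sum inequality. -/
lemma klTerm_sum_le {ι : Type*} (s : Finset ι) (a b : ι → ℝ≥0) :
    klTerm (∑ i ∈ s, a i : ℝ≥0) (∑ i ∈ s, b i : ℝ≥0) ≤ ∑ i ∈ s, klTerm (a i) (b i) := by
  by_cases hfin : ∃ i ∈ s, b i = 0 ∧ a i ≠ 0
  · obtain ⟨i, hi, hb, ha⟩ := hfin
    refine le_trans le_top (le_trans ?_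
      (Finset.single_le_sum (f := fun i => klTerm (a i) (b i)) (fun _ _ => zero_le) hi))
    simp only [hb, ENNReal.coe_zero]
    rw [klTerm_coe_zero ha]
  push Not at hfin
  have hA : ∑ i ∈ s, b i = 0 → ∑ i ∈ s, a i = 0 := fun h =>
    Finset.sum_eq_zero fun i hi => hfin i hi (Finset.sum_eq_zero_iff.1 h i hi)
  rw [klTerm_coe hA, Finset.sum_congr rfl fun i hi => klTerm_coe (hfin i hi),
    ← ENNReal.ofReal_sum_of_nonneg fun i hi => klTerm_real_nonneg (a i).coe_nonneg (b i).coe_nonneg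
      fun h => by exact_mod_cast hfin i hi (by exact_mod_cast h)]
  refine ENNReal.ofReal_le_ofReal ?_
  push_cast
  set A : ℝ := ∑ i ∈ s, (a i : ℝ) with hAdef
  set B : ℝ := ∑ i ∈ s, (b i : ℝ) with hBdef
  by_cases hA0 : A = 0
  · have : ∀ i ∈ s, (a i : ℝ) = 0 := (Finset.sum_eq_zero_iff_of_nonneg fun i _ => (a i).coe_nonneg).1 hA0
    rw [Finset.sum_congr rfl fun i hi => by rw [this i hi]]
    simp [hA0, hBdef]
  have hApos : 0 < A := lt_of_le_of_ne (Finset.sum_nonneg fun i _ => (a i).coe_nonneg) (Ne.symm hA0)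
  have hB0 : B ≠ 0 := fun h => hA0 (by
    rw [hBdef] at h
    rw [hAdef]
    exact_mod_cast hA (by exact_mod_cast h))
  have hBpos : 0 < B := lt_of_le_of_ne (Finset.sum_nonneg fun i _ => (b i).coe_nonneg) (Ne.symm hB0)
  -- Nonnegativity of the divergence term at the pair `a i`, `A / B * b i`, whose second entries
  -- have total `A`; summing over `i` gives the claim.
  have key : ∀ i ∈ s, (a i : ℝ) * Real.log (A / B) + b i - A / B * b i ≤
      a i * Real.log (a i / b i) + b i - a i := by
    intro i hi
    by_cases ha : (a i : ℝ) = 0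
    · rw [ha]; simp; positivity
    have hb : (b i : ℝ) ≠ 0 := fun h => ha (by exact_mod_cast hfin i hi (by exact_mod_cast h))
    have h1 := klTerm_real_nonneg (a := a i) (b := A / B * b i) (a i).coe_nonneg (by positivity)
      (fun h => absurd h (by positivity))
    rw [show (a i : ℝ) / (A / B * b i) = (a i / b i) / (A / B) by field_simp,
      Real.log_div (by positivity) (by positivity)] at h1
    linarith
  refine le_trans (le_of_eq ?_) (Finset.sum_le_sum key)
  rw [Finset.sum_sub_distrib, Finset.sum_add_distrib, ← Finset.sum_mul, ← Finset.mul_sum,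
    ← hAdef, ← hBdef]
  field_simp

/-- Pointwise form of the compensation inequality for mixtures. -/
lemma sum_klTerm_mixture_le {ι : Type*} (s : Finset ι) (r f : ι → ℝ≥0) (hr : ∑ i ∈ s, r i = 1)
    (m : ℝ≥0) :
    ∑ i ∈ s, klTerm (f i) (r i * ∑ j ∈ s, f j : ℝ≥0) ≤
      ∑ i ∈ s, klTerm (f i) (r i * m : ℝ≥0) := by
  by_cases hfin : ∃ i ∈ s, r i * m = 0 ∧ f i ≠ 0
  · obtain ⟨i, hi, hb, ha⟩ := hfin
    refine le_trans le_top (le_trans ?_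
      (Finset.single_le_sum (f := fun i => klTerm (f i) (r i * m : ℝ≥0)) (fun _ _ => zero_le) hi))
    simp only [hb, ENNReal.coe_zero]
    rw [klTerm_coe_zero ha]
  push Not at hfin
  have hA : ∀ i ∈ s, r i * ∑ j ∈ s, f j = 0 → f i = 0 := by
    intro i hi h
    rcases mul_eq_zero.1 h with h | h
    · exact hfin i hi (by simp [h])
    · exact Finset.sum_eq_zero_iff.1 h i hi
  rw [Finset.sum_congr rfl fun i hi => klTerm_coe (hfin i hi),
    Finset.sum_congr rfl fun i hi => klTerm_coe (hA i hi),
    ← ENNReal.ofReal_sum_of_nonneg fun i hi => klTerm_real_nonneg (f i).coe_nonneg (r i * m).coe_nonneg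
      fun h => by exact_mod_cast hfin i hi (by exact_mod_cast h),
    ← ENNReal.ofReal_sum_of_nonneg fun i hi => klTerm_real_nonneg (f i).coe_nonneg (r i * ∑ j ∈ s, f j).coe_nonneg
      fun h => by exact_mod_cast hA i hi (by exact_mod_cast h)]
  refine ENNReal.ofReal_le_ofReal ?_
  push_cast
  set F : ℝ := ∑ i ∈ s, (f i : ℝ) with hFdef
  have hr' : ∑ i ∈ s, (r i : ℝ) = 1 := by exact_mod_cast hr
  have hm : (m : ℝ) = 0 → F = 0 := fun h => Finset.sum_eq_zero fun i hi => by
    exact_mod_cast hfin i hi (by simp [show m = 0 by exact_mod_cast h])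
  have hF0 : 0 ≤ F := Finset.sum_nonneg fun i _ => (f i).coe_nonneg
  have hnn := klTerm_real_nonneg hF0 m.coe_nonneg hm
  -- Splitting the logarithm shows that, after summation, the two sides differ by exactly `F * log
  -- (F / m) + m - F`, which is nonnegative by `hnn`.
  have key : ∀ i ∈ s, (f i : ℝ) * Real.log (f i / (r i * F)) + r i * F - f i =
      (f i * Real.log (f i / (r i * m)) + r i * m - f i) - f i * Real.log (F / m)
        + r i * (F - m) := by
    intro i hi
    by_cases ha : (f i : ℝ) = 0
    · rw [ha]; simp; ring
    have h1 : (r i : ℝ) * m ≠ 0 := fun h => ha (by exact_mod_cast hfin i hi (by exact_mod_cast h))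
    have hri : (r i : ℝ) ≠ 0 := left_ne_zero_of_mul h1
    have hmi : (m : ℝ) ≠ 0 := right_ne_zero_of_mul h1
    have hFi : F ≠ 0 := fun h =>
      ha ((Finset.sum_eq_zero_iff_of_nonneg fun i _ => (f i).coe_nonneg).1 h i hi)
    rw [show (f i : ℝ) / (r i * m) = f i / (r i * F) * (F / m) by field_simp,
      Real.log_mul (by positivity) (by positivity)]
    ring
  rw [Finset.sum_congr rfl key, Finset.sum_add_distrib, Finset.sum_sub_distrib, ← Finset.sum_mul,
    ← Finset.sum_mul, hr', ← hFdef]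
  linarith

/-! ### Inequalities for the divergence of measures. -/

section

variable {α ι : Type*} [MeasurableSpace α]

lemma lintegral_density_ne_top {μ l : Measure α} [IsFiniteMeasure μ] {g : α → ℝ≥0∞}
    (h : l.withDensity g = μ) : ∫⁻ x, g x ∂l ≠ ∞ := by
  rw [← setLIntegral_univ, ← withDensity_apply _ MeasurableSet.univ, h]
  exact measure_ne_top _ _

/-- The Kullback-Leibler divergence is jointly subadditive. -/
lemma klDiv_sum_le (s : Finset ι) (κ τ : ι → Measure α) [∀ i, IsFiniteMeasure (κ i)]
    [∀ i, IsFiniteMeasure (τ i)] :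
    klDiv (∑ i ∈ s, κ i) (∑ i ∈ s, τ i) ≤ ∑ i ∈ s, klDiv (κ i) (τ i) := by
  classical
  set l : Measure α := ∑ i ∈ s, (κ i + τ i) with hl
  have hle : ∀ i ∈ s, κ i + τ i ≤ l := fun i hi =>
    Finset.single_le_sum (f := fun i => κ i + τ i) (fun _ _ => Measure.zero_le _) hi
  have hκ : ∀ i ∈ s, κ i ≪ l := fun i hi =>
    ((Measure.le_add_right le_rfl).trans (hle i hi)).absolutelyContinuous
  have hτ : ∀ i ∈ s, τ i ≪ l := fun i hi =>
    ((Measure.le_add_left le_rfl).trans (hle i hi)).absolutelyContinuous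
  choose! a ham ha using fun i hi => exists_nnreal_density (hκ i hi)
  choose! b hbm hb using fun i hi => exists_nnreal_density (hτ i hi)
  have ham' : ∀ i ∈ s, Measurable fun x => (a i x : ℝ≥0∞) := fun i hi => (ham i hi).coe_nnreal_ennreal
  have hbm' : ∀ i ∈ s, Measurable fun x => (b i x : ℝ≥0∞) := fun i hi => (hbm i hi).coe_nnreal_ennreal
  have hA := sum_withDensity l s ham'
  have hB := sum_withDensity l s hbm'
  rw [Finset.sum_congr rfl ha] at hA
  rw [Finset.sum_congr rfl hb] at hB
  have hR : ∀ i ∈ s, klDiv (κ i) (τ i) = ∫⁻ x, klTerm (a i x) (b i x) ∂l := fun i hi => by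
    rw [← klDiv_withDensity l (ham' i hi) (hbm' i hi) (lintegral_density_ne_top (ha i hi))
      (lintegral_density_ne_top (hb i hi)), ha i hi, hb i hi]
  rw [Finset.sum_congr rfl hR, ← lintegral_finsetSum _ fun i hi =>
    measurable_klTerm (ham' i hi) (hbm' i hi), hA, hB,
    klDiv_withDensity l (Finset.measurable_fun_sum _ ham') (Finset.measurable_fun_sum _ hbm')
      (lintegral_density_ne_top hA.symm) (lintegral_density_ne_top hB.symm)]
  refine lintegral_mono fun x => ?_
  have := klTerm_sum_le s (fun i => a i x) (fun i => b i x)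
  push_cast at this
  exact this

/-- Among all reference measures the mixture itself is closest to its components on average. -/
lemma sum_klDiv_mixture_le (s : Finset ι) (r : ι → ℝ≥0) (hr : ∑ i ∈ s, r i = 1)
    (κ : ι → Measure α) (τ : Measure α) [∀ i, IsFiniteMeasure (κ i)] [IsFiniteMeasure τ] :
    ∑ i ∈ s, klDiv (κ i) (r i • ∑ j ∈ s, κ j) ≤ ∑ i ∈ s, klDiv (κ i) (r i • τ) := by
  set l : Measure α := ∑ i ∈ s, κ i + τ with hl
  have hκ : ∀ i ∈ s, κ i ≪ l := fun i hi => by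
    refine Measure.absolutelyContinuous_of_le (le_trans ?_ (Measure.le_add_right le_rfl))
    exact Finset.single_le_sum (f := fun i => κ i) (fun _ _ => Measure.zero_le _) hi
  have hτ : τ ≪ l := Measure.absolutelyContinuous_of_le (Measure.le_add_left le_rfl)
  choose! a ham ha using fun i hi => exists_nnreal_density (hκ i hi)
  obtain ⟨b, hbm, hb⟩ := exists_nnreal_density hτ
  have ham' : ∀ i ∈ s, Measurable fun x => (a i x : ℝ≥0∞) := fun i hi => (ham i hi).coe_nnreal_ennreal
  have hbm' : Measurable fun x => (b x : ℝ≥0∞) := hbm.coe_nnreal_ennreal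
  have hA := sum_withDensity l s ham'
  rw [Finset.sum_congr rfl ha] at hA
  have hAm : Measurable fun x => ∑ i ∈ s, (a i x : ℝ≥0∞) := Finset.measurable_fun_sum _ ham'
  have smul_eq : ∀ (c : ℝ≥0) (g : α → ℝ≥0∞), Measurable g →
      c • l.withDensity g = l.withDensity (fun x => c * g x) := fun c g hg =>
    (withDensity_smul (c : ℝ≥0∞) hg).symm
  have hR : ∀ (g : α → ℝ≥0∞) (μ : Measure α) [IsFiniteMeasure μ], Measurable g →
      l.withDensity g = μ → ∀ i ∈ s,
      klDiv (κ i) (r i • μ) = ∫⁻ x, klTerm (a i x) (r i * g x) ∂l := fun g μ _ hg h i hi => by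
    have h' := smul_eq (r i) g hg
    rw [← klDiv_withDensity l (ham' i hi) (hg.const_mul _) (lintegral_density_ne_top (ha i hi))
      (lintegral_density_ne_top (h'.symm.trans (by rw [h]))), ha i hi, ← h', h]
  rw [Finset.sum_congr rfl (hR _ _ hAm hA.symm), Finset.sum_congr rfl (hR _ _ hbm' hb),
    ← lintegral_finsetSum _ fun i hi => measurable_klTerm (ham' i hi) (hAm.const_mul _),
    ← lintegral_finsetSum _ fun i hi => measurable_klTerm (ham' i hi) (hbm'.const_mul _)]
  refine lintegral_mono fun x => ?_
  have := sum_klTerm_mixture_le s r (fun i => a i x) hr (b x)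
  push_cast at this
  exact this

/-- Among the multiples of a probability measure `μ`, the one with the same mass as `κ`
is closest to `κ`. -/
lemma klDiv_mass_smul_le (κ μ : Measure α) [IsFiniteMeasure κ] [IsProbabilityMeasure μ] (n c : ℝ≥0)
    (hn : κ Set.univ = n) : klDiv κ (n • μ) ≤ klDiv κ (c • μ) := by
  by_cases hn0 : n = 0
  · have : κ = 0 := by simpa [hn0] using hn
    simp [hn0, this]
  by_cases hc0 : c = 0
  · have : NeZero κ := ⟨fun h => hn0 (by simpa [h] using hn.symm)⟩
    simp [hc0]
  by_cases htop : klDiv κ (c • μ) = ∞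
  · simp [htop]
  obtain ⟨hac, hint⟩ := klDiv_ne_top_iff.1 htop
  have hd : n / c ≠ 0 := div_ne_zero hn0 hc0
  have heq : n • μ = (n / c) • (c • μ) := by rw [smul_smul, div_mul_cancel₀ _ hc0]
  have hac' : κ ≪ (n / c) • (c • μ) := by
    have := hac.smul_right (c := ((n / c : ℝ≥0) : ℝ≥0∞)) (by exact_mod_cast hd)
    rwa [Measure.coe_nnreal_smul] at this
  have htop' : klDiv κ ((n / c) • (c • μ)) ≠ ∞ := by
    refine klDiv_ne_top hac' ?_
    rw [integrable_congr (llr_smul_nnreal_right hac (n / c) hd)]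
    exact hint.sub (integrable_const _)
  rw [heq, ← ENNReal.toReal_le_toReal htop' htop, toReal_klDiv_smul_right hac hint hd]
  have h1 : κ.real Set.univ = n := by simp [measureReal_def, hn]
  have h2 : (c • μ).real Set.univ = c := by simp [measureReal_def]
  rw [h1, h2]
  have hc' : (c : ℝ) ≠ 0 := by exact_mod_cast hc0
  -- Passing from `c • μ` to `n • μ` lowers the divergence by `n * log (n / c) + c - n`.
  have h3 := klTerm_real_nonneg n.coe_nonneg c.coe_nonneg (fun h => absurd h hc')
  push_cast
  have : ((n : ℝ) / c - 1) * c = n - c := by field_simp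
  rw [this]
  linarith

end

/-! ### The posterior term of AIR as divergences on the observation space. -/

section

variable {P O : Type*} [MeasurableSpace O]

/-- The part of the `ν`-mixture of the observation laws that comes from `φ`. -/
def blockMeasure (ν : Model P O × P → ℝ≥0) (φ : Finset (Model P O × P)) (π : P) : Measure O :=
  ∑ x ∈ φ, ν x • (x.1.law π : Measure O)

instance (ν : Model P O × P → ℝ≥0) (φ : Finset (Model P O × P)) (π : P) :
    IsFiniteMeasure (blockMeasure ν φ π) := by
  unfold blockMeasure; infer_instance

lemma blockMeasure_univ (ν : Model P O × P → ℝ≥0) (φ : Finset (Model P O × P)) (π : P) :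
    blockMeasure ν φ π Set.univ = (∑ x ∈ φ, ν x : ℝ≥0) := by
  simp [blockMeasure, Measure.finsetSum_apply]

lemma sum_support {A : Type*} [AddCommMonoid A] {Φ : Finset (Finset (Model P O × P))}
    (hΦ : (Φ : Set (Finset (Model P O × P))).PairwiseDisjoint id) (f : Model P O × P → A) :
    ∑ x ∈ support Φ, f x = ∑ φ ∈ Φ, ∑ x ∈ φ, f x := by
  classical
  rw [support, Finset.sum_biUnion hΦ]
  rfl

/-- The expected divergence of the posterior from `ρ`, as a sum of divergences of measures on
the observation space. -/
lemma sum_lintegral_finKL_posterior {Φ : Finset (Finset (Model P O × P))}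
    (hΦ : (Φ : Set (Finset (Model P O × P))).PairwiseDisjoint id)
    (ν : Model P O × P → ℝ≥0) (ρ : Finset (Model P O × P) → ℝ≥0) (π : P) :
    ∑ x ∈ support Φ, (ν x : ℝ≥0∞) *
        ∫⁻ o, finKL Φ (posterior Φ ν π o) (fun φ => (ρ φ : ℝ≥0∞)) ∂(x.1.law π : Measure O) =
      ∑ φ ∈ Φ, klDiv (blockMeasure ν φ π) (ρ φ • ∑ φ' ∈ Φ, blockMeasure ν φ' π) := by
  classical
  set l : Measure O := ∑ x ∈ support Φ, (x.1.law π : Measure O) with hl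
  set d : Finset (Model P O × P) → O → ℝ≥0∞ :=
    fun φ o => ∑ x ∈ φ, (ν x : ℝ≥0∞) * density Φ x.1 π o with hd
  have hgm : ∀ x : Model P O × P, Measurable (density Φ x.1 π) := fun x =>
    Measure.measurable_rnDeriv _ _
  have hg : ∀ x ∈ support Φ, l.withDensity (density Φ x.1 π) = x.1.law π := fun x hx =>
    Measure.withDensity_rnDeriv_eq _ _ (Measure.absolutelyContinuous_of_le
      (Finset.single_le_sum (f := fun x : Model P O × P => (x.1.law π : Measure O))
        (fun _ _ => Measure.zero_le _) hx))
  have hdm : ∀ φ, Measurable (d φ) := fun φ =>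
    Finset.measurable_fun_sum _ fun x _ => (hgm x).const_mul _
  have hblock : ∀ φ ∈ Φ, l.withDensity (d φ) = blockMeasure ν φ π := by
    intro φ hφ
    rw [hd, ← sum_withDensity l φ fun x _ => (hgm x).const_mul _, blockMeasure]
    refine Finset.sum_congr rfl fun x hx => ?_
    rw [← hg x (Finset.mem_biUnion.2 ⟨φ, hφ, hx⟩)]
    exact withDensity_smul (ν x : ℝ≥0∞) (hgm x)
  have htotm : Measurable fun o => ∑ φ ∈ Φ, d φ o := Finset.measurable_fun_sum _ fun φ _ => hdm φ
  have htot : l.withDensity (fun o => ∑ φ ∈ Φ, d φ o) = ∑ φ ∈ Φ, blockMeasure ν φ π := by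
    rw [← sum_withDensity l Φ fun φ _ => hdm φ]
    exact Finset.sum_congr rfl hblock
  have htop : ∀ᵐ o ∂l, ∑ φ ∈ Φ, d φ o < ∞ := ae_lt_top htotm (lintegral_density_ne_top htot)
  -- Averaging over `x` and then over the law of `x` is integration against the total mixture, whose
  -- density is the denominator of Bayes' rule.
  have hleft : ∑ x ∈ support Φ, (ν x : ℝ≥0∞) *
        ∫⁻ o, finKL Φ (posterior Φ ν π o) (fun φ => (ρ φ : ℝ≥0∞)) ∂(x.1.law π : Measure O) =
      ∫⁻ o, finKL Φ (posterior Φ ν π o) (fun φ => (ρ φ : ℝ≥0∞))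
        ∂(l.withDensity fun o => ∑ φ ∈ Φ, d φ o) := by
    rw [htot]
    simp only [blockMeasure]
    rw [← sum_support hΦ (fun x => ν x • (x.1.law π : Measure O)), lintegral_finsetSum_measure]
    refine Finset.sum_congr rfl fun x _ => ?_
    exact (lintegral_smul_measure (R := ℝ≥0∞) (c := (ν x : ℝ≥0∞)) _).symm
  have hright : ∀ φ ∈ Φ, klDiv (blockMeasure ν φ π) (ρ φ • ∑ φ' ∈ Φ, blockMeasure ν φ' π) =
      ∫⁻ o, klTerm (d φ o) (ρ φ * ∑ φ' ∈ Φ, d φ' o) ∂l := by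
    intro φ hφ
    have h' : l.withDensity (fun o => ρ φ * ∑ φ' ∈ Φ, d φ' o) =
        ρ φ • ∑ φ' ∈ Φ, blockMeasure ν φ' π := by
      rw [← htot]
      exact withDensity_smul (ρ φ : ℝ≥0∞) htotm
    rw [← klDiv_withDensity l (hdm φ) (htotm.const_mul _)
      (lintegral_density_ne_top (hblock φ hφ)) (lintegral_density_ne_top h'), h', hblock φ hφ]
  -- This change of density needs no measurability of the posterior divergence, only that the total
  -- density is finite almost everywhere.
  rw [hleft, lintegral_withDensity_eq_lintegral_mul_non_measurable₀ _ htotm.aemeasurable htop,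
    Finset.sum_congr rfl hright, ← lintegral_finsetSum _ fun φ _ =>
      measurable_klTerm (hdm φ) (htotm.const_mul _)]
  refine lintegral_congr_ae ?_
  filter_upwards [htop] with o ho
  simp only [Pi.mul_apply]
  have hle : ∀ φ ∈ Φ, d φ o ≤ ∑ φ ∈ Φ, d φ o := fun φ hφ =>
    Finset.single_le_sum (f := fun φ => d φ o) (fun _ _ => zero_le) hφ
  set m : ℝ≥0∞ := ∑ φ ∈ Φ, d φ o with hm
  by_cases h0 : m = 0
  · rw [h0, zero_mul]
    refine (Finset.sum_eq_zero fun φ hφ => ?_).symm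
    have : d φ o = 0 := le_antisymm (h0 ▸ hle φ hφ) zero_le
    simp [this, klTerm]
  · have hpost : ∀ φ, posterior Φ ν π o φ = d φ o / m := fun φ => rfl
    rw [finKL_eq_sum _ (fun _ _ => ENNReal.coe_ne_top), Finset.mul_sum]
    · refine Finset.sum_congr rfl fun φ hφ => ?_
      rw [mul_klTerm h0 ho.ne, hpost, ENNReal.mul_div_cancel h0 ho.ne, mul_comm m]
    · intro φ hφ
      rw [hpost]
      exact (ENNReal.div_lt_top ((hle φ hφ).trans_lt ho).ne h0).ne

end

/-! ### Arithmetic with possibly infinite penalties. -/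

section

/-- No finiteness of `k` is needed: for `w = 0` and `k = ∞` both `0 * ⊥` and `0 * ∞` are zero. -/
lemma mul_coe_sub_coe_ennreal (w : ℝ≥0) (a : ℝ) (k : ℝ≥0∞) :
    ((w : ℝ) : EReal) * ((a : EReal) - (k : EReal)) =
      ((w * a : ℝ) : EReal) - ((w * k : ℝ≥0∞) : EReal) := by
  by_cases hw : w = 0
  · simp [hw]
  have hw' : (0 : ℝ) < w := by positivity
  induction k with
  | top => simp [hw, EReal.coe_mul_bot_of_pos hw', ENNReal.mul_top]
  | coe k =>
    rw [← ENNReal.coe_mul]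
    change ((w : ℝ) : EReal) * ((a : EReal) - ((k : ℝ) : EReal)) =
      ((w * a : ℝ) : EReal) - (((w * k : ℝ≥0) : ℝ) : EReal)
    norm_cast
    push_cast
    ring

lemma coe_mul_coe_ennreal {c : ℝ} (hc : 0 ≤ c) (k : ℝ≥0∞) :
    (c : EReal) * (k : EReal) = ((ENNReal.ofReal c * k : ℝ≥0∞) : EReal) := by
  rw [EReal.coe_ennreal_mul, EReal.coe_ennreal_ofReal, max_eq_left hc]

/-- No summand is `⊤`, so a single infinite `k i` makes both sides `⊥`. -/
lemma sum_coe_sub_coe_ennreal {ι : Type*} (s : Finset ι) (a : ι → ℝ) (k : ι → ℝ≥0∞) :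
    ∑ i ∈ s, ((a i : EReal) - (k i : EReal)) =
      ((∑ i ∈ s, a i : ℝ) : EReal) - ((∑ i ∈ s, k i : ℝ≥0∞) : EReal) := by
  classical
  induction s using Finset.induction_on with
  | empty => simp
  | insert i s hi ih =>
    rw [Finset.sum_insert hi, Finset.sum_insert hi, Finset.sum_insert hi, ih]
    generalize ∑ i ∈ s, a i = A
    generalize ∑ i ∈ s, k i = K
    generalize k i = k'
    generalize a i = a'
    induction K with
    | top => simp
    | coe K =>
      induction k' with
      | top => simp
      | coe k' =>
        rw [← ENNReal.coe_add]
        change ((a' : EReal) - ((k' : ℝ) : EReal)) + ((A : EReal) - ((K : ℝ) : EReal)) =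
          ((a' + A : ℝ) : EReal) - (((k' + K : ℝ≥0) : ℝ) : EReal)
        norm_cast
        push_cast
        ring

lemma sum_coe_nnreal_mul {ι : Type*} (s : Finset ι) (w : ι → ℝ≥0) (x : EReal) :
    ∑ i ∈ s, ((w i : ℝ) : EReal) * x = ((∑ i ∈ s, w i : ℝ≥0) : ℝ) * x := by
  classical
  induction s using Finset.induction_on with
  | empty => simp
  | insert i s hi ih =>
    rw [Finset.sum_insert hi, Finset.sum_insert hi, ih, NNReal.coe_add, EReal.coe_add,
      EReal.right_distrib_of_nonneg (by exact_mod_cast (w i).coe_nonneg)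
        (by exact_mod_cast (∑ i ∈ s, w i).coe_nonneg)]

end

/-! ### Exchange of quantifiers by separation. -/

/-- If every point of the convex hull of `A` has a coordinate that is at most `c`, then some
probability weights make all averages over points of `A` at most `c`. -/
lemma exists_simplex_sum_le {P : Type*} [Fintype P] [Nonempty P] (A : Set (P → ℝ)) (c : ℝ)
    (h : ∀ v ∈ convexHull ℝ A, ∃ π, v π ≤ c) :
    ∃ p ∈ simplex (Finset.univ : Finset P), ∀ v ∈ A, ∑ π, (p π : ℝ) * v π ≤ c := by
  classical
  rcases A.eq_empty_or_nonempty with rfl | ⟨v₀, hv₀⟩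
  · obtain ⟨π⟩ := ‹Nonempty P›
    exact ⟨Pi.single π 1, ⟨by simp, by simp⟩, by simp⟩
  -- The hypothesis says that the hull misses this open orthant; the normalised normal of a
  -- separating hyperplane is the required distribution.
  let s : Set (P → ℝ) := Set.univ.pi fun _ => Set.Ioi c
  have hs : ∀ v, v ∈ s ↔ ∀ π, c < v π := fun v => by simp [s]
  have hdisj : Disjoint s (convexHull ℝ A) := by
    rw [Set.disjoint_left]
    intro v hv hv'
    obtain ⟨π, hπ⟩ := h v hv'
    exact absurd ((hs v).1 hv π) (not_lt.2 hπ)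
  obtain ⟨f, u, hf, hu⟩ := geometric_hahn_banach_open
    (convex_pi fun _ _ => convex_Ioi c) (isOpen_set_pi Set.finite_univ fun _ _ => isOpen_Ioi)
    (convex_convexHull ℝ A) hdisj
  let q : P → ℝ := fun π => - f (Pi.single π 1)
  have hfq : ∀ v, f v = - ∑ π, q π * v π := fun v => by
    conv_lhs => rw [← Finset.univ_sum_single v, map_sum]
    rw [← Finset.sum_neg_distrib]
    refine Finset.sum_congr rfl fun π _ => ?_
    rw [show (Pi.single π (v π) : P → ℝ) = v π • Pi.single π 1 by
      rw [← Pi.single_smul, smul_eq_mul, mul_one], map_smul, smul_eq_mul]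
    simp only [q]
    ring
  have hq : ∀ π, 0 ≤ q π := by
    intro π
    by_contra! hneg
    have ha : ∀ t : ℝ, 0 ≤ t → f (fun _ => c + 1) - t * q π < u := by
      intro t ht
      have hmem : ((fun _ => c + 1) + t • Pi.single π 1 : P → ℝ) ∈ s := (hs _).2 fun π' => by
        have : 0 ≤ (Pi.single π 1 : P → ℝ) π' := by
          by_cases h' : π' = π
          · subst h'; simp
          · simp [h']
        simp only [Pi.add_apply, Pi.smul_apply, smul_eq_mul]
        nlinarith
      have h1 := hf _ hmem
      rw [map_add, map_smul, smul_eq_mul] at h1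
      simp only [q]
      linarith
    have h0 := ha 0 le_rfl
    -- For this `t` the left side of `ha` equals `u`, contradicting strictness: a negative
    -- coordinate would make `f` unbounded above on the orthant.
    have h1 := ha ((u - f (fun _ => c + 1)) / (- q π)) (div_nonneg (by linarith) (by linarith))
    have h2 : (u - f (fun _ => c + 1)) / (- q π) * q π = - (u - f (fun _ => c + 1)) := by
      have := hneg.ne
      field_simp
    linarith
  set Q : ℝ := ∑ π, q π with hQ
  have hconst : ∀ ε > 0, - (Q * (c + ε)) < u := fun ε hε => by
    have h1 := hf (fun _ => c + ε) ((hs _).2 fun _ => by linarith)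
    rwa [hfq, ← Finset.sum_mul] at h1
  have hv : ∀ v ∈ A, ∑ π, q π * v π ≤ - u := fun v hv => by
    have h1 := hu v (subset_convexHull ℝ A hv)
    rw [hfq] at h1
    linarith
  have hQpos : 0 < Q := by
    refine lt_of_le_of_ne (Finset.sum_nonneg fun π _ => hq π) fun hQ0 => ?_
    have hq0 : ∀ π, q π = 0 := fun π =>
      (Finset.sum_eq_zero_iff_of_nonneg fun π _ => hq π).1 hQ0.symm π (Finset.mem_univ π)
    have h1 := hconst 1 one_pos
    have h2 := hv v₀ hv₀
    simp only [hq0, zero_mul, Finset.sum_const_zero] at h2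
    rw [← hQ0] at h1
    linarith
  have hp : ∀ π, ((q π / Q).toNNReal : ℝ) = q π / Q := fun π =>
    Real.coe_toNNReal _ (div_nonneg (hq π) hQpos.le)
  refine ⟨fun π => (q π / Q).toNNReal, ⟨by simp, ?_⟩, fun v hvA => ?_⟩
  · rw [← NNReal.coe_inj]
    push_cast
    simp only [hp]
    rw [← Finset.sum_div, ← hQ, div_self hQpos.ne']
  · refine le_of_forall_pos_le_add fun ε hε => ?_
    have h1 := hconst ε hε
    have h2 := hv v hvA
    simp only [hp]
    have h3 : ∑ π, q π / Q * v π = (∑ π, q π * v π) / Q := by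
      rw [Finset.sum_div]
      exact Finset.sum_congr rfl fun π _ => by ring
    rw [h3, div_le_iff₀ hQpos]
    linarith

/-! ### Mixtures of models, blocks of `Θ × Π`, and the upper bound by the DEC. -/

section

variable {P O : Type*} [MeasurableSpace O]

lemma co_mono {S T : Set (Model P O)} (h : S ⊆ T) : co S ⊆ co T := by
  rintro N ⟨t, w, ht, hN⟩
  exact ⟨t, w, ht.trans h, hN⟩

lemma subset_co (S : Set (Model P O)) : S ⊆ co S := by
  intro M hM
  exact ⟨{M}, fun _ => 1, by simpa using hM, by simp, by simp, by simp⟩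

/-- Mixtures of finite families of models exist. -/
lemma exists_mixture {ι : Type*} (s : Finset ι) (g : ι → Model P O) (w : ι → ℝ≥0)
    (hw : ∑ i ∈ s, w i = 1) :
    ∃ N ∈ co (g '' s), (∀ π, (N.law π : Measure O) = ∑ i ∈ s, w i • ((g i).law π : Measure O)) ∧
      ∀ π, N.value π = ∑ i ∈ s, (w i : ℝ) * (g i).value π := by
  classical
  have hw' : ∑ i ∈ s, (w i : ℝ) = 1 := by exact_mod_cast hw
  let N : Model P O :=
    { law := fun π => ⟨∑ i ∈ s, w i • ((g i).law π : Measure O), ⟨by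
        simp only [Measure.finsetSum_apply, Measure.smul_apply, measure_univ]
        have : ∀ i, w i • (1 : ℝ≥0∞) = w i := fun i => by simp [ENNReal.smul_def]
        simp only [this]
        exact_mod_cast hw⟩⟩
      value := fun π => ∑ i ∈ s, (w i : ℝ) * (g i).value π
      value_mem := fun π => ⟨Finset.sum_nonneg fun i _ =>
          mul_nonneg (w i).coe_nonneg ((g i).value_mem π).1, by
        rw [← hw']
        exact Finset.sum_le_sum fun i _ =>
          mul_le_of_le_one_right (w i).coe_nonneg ((g i).value_mem π).2⟩ }
  have hmaps : ∀ i ∈ s, g i ∈ s.image g := fun i hi => Finset.mem_image_of_mem g hi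
  -- The family `g` may repeat a model, so weights are added up along its fibres.
  refine ⟨N, ⟨s.image g, fun M => ∑ i ∈ s with g i = M, w i, by simp, ?_, fun π => ?_,
    fun π => ?_⟩, fun π => rfl, fun π => rfl⟩
  · rw [Finset.sum_fiberwise_of_maps_to hmaps, hw]
  · change ∑ i ∈ s, w i • ((g i).law π : Measure O) = _
    rw [← Finset.sum_fiberwise_of_maps_to hmaps]
    refine Finset.sum_congr rfl fun M _ => ?_
    rw [Finset.sum_smul]
    refine Finset.sum_congr rfl fun i hi => ?_
    rw [(Finset.mem_filter.1 hi).2]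
  · change ∑ i ∈ s, (w i : ℝ) * (g i).value π = _
    rw [← Finset.sum_fiberwise_of_maps_to hmaps]
    refine Finset.sum_congr rfl fun M _ => ?_
    rw [NNReal.coe_sum, Finset.sum_mul]
    refine Finset.sum_congr rfl fun i hi => ?_
    rw [(Finset.mem_filter.1 hi).2]

lemma mem_prodPolicies [Fintype P] {Θ : Finset (Finset (Model P O))}
    {φ : Finset (Model P O × P)} :
    φ ∈ prodPolicies Θ ↔ ∃ θ ∈ Θ, ∃ π : P, φ = θ ×ˢ {π} := by
  classical
  simp only [prodPolicies, Finset.mem_image, Finset.mem_product, Finset.mem_univ, and_true,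
    Prod.exists]
  constructor
  · rintro ⟨θ, π, hθ, rfl⟩
    exact ⟨θ, hθ, π, rfl⟩
  · rintro ⟨θ, hθ, π, rfl⟩
    exact ⟨θ, π, hθ, rfl⟩

lemma pairwiseDisjoint_prodPolicies [Fintype P] {Θ : Finset (Finset (Model P O))}
    (hΘ : (Θ : Set (Finset (Model P O))).PairwiseDisjoint id) :
    (prodPolicies (P := P) Θ : Set (Finset (Model P O × P))).PairwiseDisjoint id := by
  intro φ hφ φ' hφ' hne
  obtain ⟨θ, hθ, π, rfl⟩ := mem_prodPolicies.1 hφ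
  obtain ⟨θ', hθ', π', rfl⟩ := mem_prodPolicies.1 hφ'
  change Disjoint (θ ×ˢ {π}) (θ' ×ˢ {π'})
  rw [Finset.disjoint_left]
  rintro ⟨M, π''⟩ h h'
  simp only [Finset.mem_product, Finset.mem_singleton] at h h'
  obtain ⟨hM, rfl⟩ := h
  obtain ⟨hM', rfl⟩ := h'
  refine hne ?_
  congr 1
  by_contra hθθ'
  exact Finset.disjoint_left.1 (hΘ hθ hθ' hθθ') hM hM'

variable [Fintype P]

/-- Separates AIR into one real number and one `ℝ≥0∞` penalty, so that the two can be compared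
independently and no indeterminate form arises. -/
lemma AIR_eq {Φ : Finset (Finset (Model P O × P))}
    (hΦ : (Φ : Set (Finset (Model P O × P))).PairwiseDisjoint id)
    (ρ : Finset (Model P O × P) → ℝ≥0) {η : ℝ} (hη : 0 < η) (p : P → ℝ≥0)
    (ν : Model P O × P → ℝ≥0) :
    AIR Φ ρ η p ν =
      ((∑ π, (p π : ℝ) * ∑ φ ∈ Φ, ∑ x ∈ φ, (ν x : ℝ) * (x.1.value x.2 - x.1.value π) : ℝ) : EReal) -
      ((∑ π, (p π : ℝ≥0∞) * (ENNReal.ofReal (1 / η) *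
        ∑ φ ∈ Φ, klDiv (blockMeasure ν φ π) (ρ φ • ∑ φ' ∈ Φ, blockMeasure ν φ' π)) : ℝ≥0∞) :
          EReal) := by
  have hc : 0 ≤ 1 / η := by positivity
  unfold AIR
  simp only [coe_mul_coe_ennreal hc, mul_coe_sub_coe_ennreal, sum_coe_sub_coe_ennreal]
  congr 2
  · refine Finset.sum_congr rfl fun π _ => ?_
    rw [sum_support hΦ]
  · refine Finset.sum_congr rfl fun π _ => ?_
    rw [← sum_lintegral_finKL_posterior hΦ]
    congr 1
    rw [Finset.mul_sum]
    exact Finset.sum_congr rfl fun x _ => by ring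

/-- The expectation under `p` in the definition of the DEC. -/
lemma sum_regret_sub_klDiv_eq {η : ℝ} (hη : 0 < η) (p : P → ℝ≥0) (M Mbar : Model P O) :
    ∑ π : P, ((p π : ℝ) : EReal) *
      ((((⨆ π', M.value π') - M.value π : ℝ) : EReal) -
        ((1 / η : ℝ) : EReal) *
          (klDiv (M.law π : Measure O) (Mbar.law π : Measure O) : EReal)) =
      ((∑ π, (p π : ℝ) * ((⨆ π', M.value π') - M.value π) : ℝ) : EReal) -
      ((∑ π, (p π : ℝ≥0∞) * (ENNReal.ofReal (1 / η) *
        klDiv (M.law π : Measure O) (Mbar.law π : Measure O)) : ℝ≥0∞) : EReal) := by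
  have hc : 0 ≤ 1 / η := by positivity
  simp only [coe_mul_coe_ennreal hc, mul_coe_sub_coe_ennreal, sum_coe_sub_coe_ennreal]

/-- The max-min value of `AIR` is at most the DEC. -/
lemma maxMinAIR_le_DEC {ℳ : Finset (Model P O)} {Θ : Finset (Finset (Model P O))}
    (hΘ : (Θ : Set (Finset (Model P O))).PairwiseDisjoint id) (hℳ : ∀ θ ∈ Θ, θ ⊆ ℳ)
    {η : ℝ} (hη : 0 < η) :
    maxMinAIR η (prodPolicies Θ) ≤ DEC η (convexification ℳ (prodPolicies (P := P) Θ)) := by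
  classical
  have hΦ := pairwiseDisjoint_prodPolicies (P := P) hΘ
  set Φ := prodPolicies (P := P) Θ with hΦdef
  set S := convexification ℳ Φ with hS
  have hblock : ∀ φ ∈ Φ, co (Prod.fst '' (φ : Set (Model P O × P))) ⊆ S := by
    intro φ hφ N hN
    refine Set.mem_biUnion hφ (co_mono ?_ hN)
    rintro _ ⟨⟨M, π⟩, hx, rfl⟩
    refine ⟨?_, π, hx⟩
    obtain ⟨θ, hθ, π', rfl⟩ := mem_prodPolicies.1 hφ
    exact hℳ θ hθ (Finset.mem_product.1 hx).1
  refine iSup₂_le fun ρ _ => iSup₂_le fun ν hν => ?_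
  obtain ⟨Mbar, hMbar, hlaw, -⟩ := exists_mixture (support Φ) Prod.fst ν hν.2
  have hMbarS : Mbar ∈ co S := by
    refine co_mono ?_ hMbar
    rintro _ ⟨x, hx, rfl⟩
    obtain ⟨φ, hφ, hxφ⟩ := Finset.mem_biUnion.1 hx
    exact hblock φ hφ (subset_co _ ⟨x, hxφ, rfl⟩)
  have htot : ∀ π, ∑ φ ∈ Φ, blockMeasure ν φ π = Mbar.law π := fun π => by
    rw [hlaw, sum_support hΦ]
    rfl
  refine le_iSup₂_of_le Mbar hMbarS (iInf₂_mono fun p _ => ?_)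
  set B : EReal := ⨆ M ∈ S, ∑ π : P, ((p π : ℝ) : EReal) *
      ((((⨆ π', M.value π') - M.value π : ℝ) : EReal) -
        ((1 / η : ℝ) : EReal) *
          (klDiv (M.law π : Measure O) (Mbar.law π : Measure O) : EReal)) with hB
  let n : Finset (Model P O × P) → ℝ≥0 := fun φ => ∑ x ∈ φ, ν x
  let A : Finset (Model P O × P) → ℝ := fun φ =>
    ∑ π, (p π : ℝ) * ∑ x ∈ φ, (ν x : ℝ) * (x.1.value x.2 - x.1.value π)
  let K : Finset (Model P O × P) → ℝ≥0∞ := fun φ =>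
    ∑ π, (p π : ℝ≥0∞) * (ENNReal.ofReal (1 / η) *
      klDiv (blockMeasure ν φ π) (n φ • (Mbar.law π : Measure O)))
  have hterm : ∀ φ ∈ Φ, (A φ : EReal) - (K φ : EReal) ≤ ((n φ : ℝ) : EReal) * B := by
    intro φ hφ
    -- A block of mass zero has no conditional mixture, but contributes nothing to the regret.
    by_cases hn : n φ = 0
    · have hν0 : ∀ x ∈ φ, ν x = 0 := Finset.sum_eq_zero_iff.1 hn
      have hA : A φ = 0 := by
        refine Finset.sum_eq_zero fun π _ => ?_
        rw [Finset.sum_eq_zero fun x hx => by rw [hν0 x hx]; simp, mul_zero]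
      rw [hA, hn]
      simpa using EReal.coe_ennreal_nonneg _
    · obtain ⟨N, hN, hNlaw, hNval⟩ := exists_mixture φ Prod.fst (fun x => ν x / n φ) (by
        rw [← Finset.sum_div]; exact div_self hn)
      have hn' : (n φ : ℝ) ≠ 0 := by exact_mod_cast hn
      have hlawN : ∀ π, blockMeasure ν φ π = n φ • (N.law π : Measure O) := fun π => by
        rw [hNlaw, Finset.smul_sum]
        refine Finset.sum_congr rfl fun x _ => ?_
        rw [smul_smul, mul_div_cancel₀ _ hn]
      have hvalN : ∀ π, ∑ x ∈ φ, (ν x : ℝ) * x.1.value π = n φ * N.value π := fun π => by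
        rw [hNval, Finset.mul_sum]
        refine Finset.sum_congr rfl fun x _ => ?_
        push_cast
        field_simp
      have hK : K φ = n φ * ∑ π, (p π : ℝ≥0∞) * (ENNReal.ofReal (1 / η) *
          klDiv (N.law π : Measure O) (Mbar.law π : Measure O)) := by
        rw [Finset.mul_sum]
        refine Finset.sum_congr rfl fun π _ => ?_
        rw [hlawN, klDiv_smul_same]
        ring
      have hA : A φ ≤ n φ * ∑ π, (p π : ℝ) * ((⨆ π', N.value π') - N.value π) := by
        rw [Finset.mul_sum]
        refine Finset.sum_le_sum fun π _ => ?_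
        -- The comparator policy is constant on the block, so the averaged comparator value is a
        -- value of the single model `N`.
        obtain ⟨θ, hθ, π₀, hφeq⟩ := mem_prodPolicies.1 hφ
        have h1 : ∑ x ∈ φ, (ν x : ℝ) * (x.1.value x.2 - x.1.value π) =
            n φ * (N.value π₀ - N.value π) := by
          rw [mul_sub, ← hvalN, ← hvalN, ← Finset.sum_sub_distrib]
          refine Finset.sum_congr rfl fun x hx => ?_
          have : x.2 = π₀ := by
            rw [hφeq] at hx
            exact Finset.mem_singleton.1 (Finset.mem_product.1 hx).2
          rw [this]
          ring
        rw [h1]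
        have h2 : N.value π₀ ≤ ⨆ π', N.value π' := le_ciSup (Set.finite_range _).bddAbove π₀
        calc (p π : ℝ) * (n φ * (N.value π₀ - N.value π))
            ≤ p π * (n φ * ((⨆ π', N.value π') - N.value π)) := by gcongr
          _ = _ := by ring
      calc (A φ : EReal) - (K φ : EReal)
          ≤ ((n φ * ∑ π, (p π : ℝ) * ((⨆ π', N.value π') - N.value π) : ℝ) : EReal) - K φ :=
            EReal.sub_le_sub (EReal.coe_le_coe_iff.2 hA) le_rfl
        _ = ((n φ : ℝ) : EReal) * (∑ π : P, ((p π : ℝ) : EReal) *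
              ((((⨆ π', N.value π') - N.value π : ℝ) : EReal) -
                ((1 / η : ℝ) : EReal) *
                  (klDiv (N.law π : Measure O) (Mbar.law π : Measure O) : EReal))) := by
            rw [hK, sum_regret_sub_klDiv_eq hη, mul_coe_sub_coe_ennreal]
        _ ≤ ((n φ : ℝ) : EReal) * B := by
            refine mul_le_mul_of_nonneg_left ?_ (by exact_mod_cast (n φ).coe_nonneg)
            exact le_iSup₂ (f := fun (M : Model P O) (_ : M ∈ S) => ∑ π : P, ((p π : ℝ) : EReal) *
              ((((⨆ π', M.value π') - M.value π : ℝ) : EReal) -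
                ((1 / η : ℝ) : EReal) *
                  (klDiv (M.law π : Measure O) (Mbar.law π : Measure O) : EReal)))
              N (hblock φ hφ hN)
  have hnsum : ∑ φ ∈ Φ, n φ = 1 := by rw [← hν.2, sum_support hΦ]
  calc AIR Φ ρ η p ν ≤ ((∑ φ ∈ Φ, A φ : ℝ) : EReal) - ((∑ φ ∈ Φ, K φ : ℝ≥0∞) : EReal) := by
        rw [AIR_eq hΦ ρ hη]
        refine EReal.sub_le_sub (le_of_eq ?_) (EReal.coe_ennreal_le_coe_ennreal_iff.2 ?_)
        · simp only [A, Finset.mul_sum]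
          rw [Finset.sum_comm]
        · simp only [K]
          rw [Finset.sum_comm]
          refine Finset.sum_le_sum fun π _ => ?_
          rw [← Finset.mul_sum, ← Finset.mul_sum, htot]
          gcongr with φ hφ
          -- The marginal of `ν` on `Φ` is the best choice of `ρ`.
          exact klDiv_mass_smul_le _ _ _ _ (blockMeasure_univ ν φ π)
    _ = ∑ φ ∈ Φ, ((A φ : EReal) - (K φ : EReal)) := (sum_coe_sub_coe_ennreal _ _ _).symm
    _ ≤ ∑ φ ∈ Φ, ((n φ : ℝ) : EReal) * B := Finset.sum_le_sum hterm
    _ = B := by rw [sum_coe_nnreal_mul, hnsum]; simp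

end

/-! ### The lower bound by the DEC. -/

lemma sum_product_singleton {α β A : Type*} [AddCommMonoid A] {t s : Finset α} (hts : t ⊆ s)
    {b : β} (f : α × β → A) (hf : ∀ a, a ∉ t → f (a, b) = 0) :
    ∑ x ∈ s ×ˢ {b}, f x = ∑ a ∈ t, f (a, b) := by
  rw [Finset.sum_product]
  simp only [Finset.sum_singleton]
  exact (Finset.sum_subset hts fun a _ ha => hf a ha).symm

/-- Sums over a block of a partition, weighted by a mixture of weights each of which is
supported in a single block. -/
lemma sum_mixture_smul {ι X A : Type*} [Fintype ι] [DecidableEq X] [AddCommMonoid A]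
    [Module ℝ≥0 A] {Φ : Finset (Finset X)} (hΦ : (Φ : Set (Finset X)).PairwiseDisjoint id) (α : ι → ℝ≥0)
    {b : ι → Finset X} (hb : ∀ i, b i ∈ Φ) {u : ι → X → ℝ≥0} (hu : ∀ i x, x ∉ b i → u i x = 0)
    (f : X → A) (φ : Finset X) (hφ : φ ∈ Φ) :
    ∑ x ∈ φ, (∑ i, α i * u i x) • f x = ∑ i with b i = φ, α i • ∑ x ∈ b i, u i x • f x := by
  simp only [Finset.sum_smul]
  rw [Finset.sum_comm, Finset.sum_filter]
  refine Finset.sum_congr rfl fun i _ => ?_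
  split_ifs with h
  · rw [h, Finset.smul_sum]
    exact Finset.sum_congr rfl fun x _ => mul_smul _ _ _
  · refine Finset.sum_eq_zero fun x hx => ?_
    have : x ∉ b i := Finset.disjoint_right.1 (hΦ (hb i) hφ h) hx
    simp [hu i x this]

section

variable {P O : Type*} [MeasurableSpace O] [Fintype P] [Nonempty P]

/-- A model of the convexification is a mixture over one element of `Θ × Π` whose policy
component is optimal for the model. -/
lemma exists_optimal_block {ℳ : Finset (Model P O)} {Θ : Finset (Finset (Model P O))}
    {M : Model P O} (hM : M ∈ convexification ℳ (prodPolicies (P := P) Θ)) :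
    ∃ φ ∈ prodPolicies (P := P) Θ, ∃ u : Model P O × P → ℝ≥0,
      (∀ x, x ∉ φ → u x = 0) ∧ ∑ x ∈ φ, u x = 1 ∧
      (∀ π, (M.law π : Measure O) = ∑ x ∈ φ, u x • (x.1.law π : Measure O)) ∧
      (∀ π, M.value π = ∑ x ∈ φ, (u x : ℝ) * x.1.value π) ∧
      ⨆ π, M.value π = ∑ x ∈ φ, (u x : ℝ) * x.1.value x.2 := by
  classical
  simp only [convexification, Set.mem_iUnion] at hM
  obtain ⟨φ', hφ', t, w, ht, hw, hlaw, hval⟩ := hM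
  obtain ⟨θ, hθ, π', rfl⟩ := mem_prodPolicies.1 hφ'
  obtain ⟨π₀, hπ₀⟩ := exists_eq_ciSup_of_finite (f := M.value)
  have htθ : t ⊆ θ := fun N hN => by
    obtain ⟨-, π, hπ⟩ := ht hN
    exact (Finset.mem_product.1 hπ).1
  -- The policy `π'` of the original block is discarded for the optimal `π₀`; `θ × {π₀}` is again in
  -- `Θ × Π`.
  let u : Model P O × P → ℝ≥0 := fun x => if x.1 ∈ t ∧ x.2 = π₀ then w x.1 else 0
  have hu : ∀ N ∈ t, u (N, π₀) = w N := fun N hN => by simp [u, hN]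
  have hu0 : ∀ N, N ∉ t → u (N, π₀) = 0 := fun N hN => by simp [u, hN]
  refine ⟨θ ×ˢ {π₀}, mem_prodPolicies.2 ⟨θ, hθ, π₀, rfl⟩, u, ?_, ?_, fun π => ?_, fun π => ?_, ?_⟩
  · intro x hx
    refine if_neg fun h => hx (Finset.mem_product.2 ⟨htθ h.1, Finset.mem_singleton.2 h.2⟩)
  · rw [sum_product_singleton htθ u hu0, ← hw]
    exact Finset.sum_congr rfl hu
  · rw [sum_product_singleton htθ (fun x => u x • (x.1.law π : Measure O))
      fun N hN => by simp [hu0 N hN], hlaw]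
    exact Finset.sum_congr rfl fun N hN => by rw [hu N hN]
  · rw [sum_product_singleton htθ (fun x => (u x : ℝ) * x.1.value π) fun N hN => by simp [hu0 N hN], hval]
    exact Finset.sum_congr rfl fun N hN => by rw [hu N hN]
  · rw [sum_product_singleton htθ (fun x => (u x : ℝ) * x.1.value x.2)
      fun N hN => by simp [hu0 N hN], ← hπ₀, hval]
    exact Finset.sum_congr rfl fun N hN => by rw [hu N hN]

/-- A mixture over models of the convexification yields a prior `ν`, with `ρ` its law on `Φ`,
for which `AIR` is at least the averaged objective of the DEC. -/
lemma exists_AIR_ge {ℳ : Finset (Model P O)} {Θ : Finset (Finset (Model P O))}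
    (hΘ : (Θ : Set (Finset (Model P O))).PairwiseDisjoint id) {η : ℝ} (hη : 0 < η)
    {ι : Type*} [Fintype ι] (α : ι → ℝ≥0) (hα : ∑ i, α i = 1) (M : ι → Model P O)
    (hM : ∀ i, M i ∈ convexification ℳ (prodPolicies (P := P) Θ)) (Mbar : Model P O) :
    ∃ ρ ∈ simplex (prodPolicies (P := P) Θ), ∃ ν ∈ simplex (support (prodPolicies (P := P) Θ)),
      ∀ p : P → ℝ≥0,
        ((∑ π, (p π : ℝ) * ∑ i, (α i : ℝ) * ((⨆ π', (M i).value π') - (M i).value π) : ℝ) :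
            EReal) -
          ((∑ π, (p π : ℝ≥0∞) * (ENNReal.ofReal (1 / η) * ∑ i, (α i : ℝ≥0∞) *
            klDiv ((M i).law π : Measure O) (Mbar.law π : Measure O)) : ℝ≥0∞) : EReal) ≤
        AIR (prodPolicies Θ) ρ η p ν := by
  classical
  have hΦ := pairwiseDisjoint_prodPolicies (P := P) hΘ
  choose b hb u hu0 hu1 hulaw huval husup using fun i => exists_optimal_block (hM i)
  set Φ := prodPolicies (P := P) Θ with hΦdef
  let ν : Model P O × P → ℝ≥0 := fun x => ∑ i, α i * u i x
  let n : Finset (Model P O × P) → ℝ≥0 := fun φ => ∑ i with b i = φ, α i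
  have hmaps : ∀ i ∈ (Finset.univ : Finset ι), b i ∈ Φ := fun i _ => hb i
  have hn : ∀ φ ∈ Φ, ∑ x ∈ φ, ν x = n φ := by
    intro φ hφ
    have := sum_mixture_smul hΦ α hb hu0 (fun _ => (1 : ℝ≥0)) φ hφ
    simp only [smul_eq_mul, mul_one, hu1] at this
    exact this
  have hnsum : ∑ φ ∈ Φ, n φ = 1 := by
    rw [← hα]
    exact Finset.sum_fiberwise_of_maps_to hmaps _
  have hblock : ∀ φ ∈ Φ, ∀ π, blockMeasure ν φ π =
      ∑ i with b i = φ, α i • ((M i).law π : Measure O) := by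
    intro φ hφ π
    refine (sum_mixture_smul hΦ α hb hu0 (fun x => (x.1.law π : Measure O)) φ hφ).trans ?_
    exact Finset.sum_congr rfl fun i _ => by rw [hulaw]
  refine ⟨fun φ => if φ ∈ Φ then n φ else 0, ⟨fun φ hφ => if_neg hφ, ?_⟩, ν, ⟨?_, ?_⟩, fun p => ?_⟩
  · rw [Finset.sum_congr rfl fun φ hφ => if_pos hφ, hnsum]
  · intro x hx
    refine Finset.sum_eq_zero fun i _ => ?_
    rw [hu0 i x fun h => hx (Finset.mem_biUnion.2 ⟨b i, hb i, h⟩), mul_zero]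
  · rw [sum_support hΦ, Finset.sum_congr rfl hn, hnsum]
  · rw [AIR_eq hΦ _ hη]
    refine EReal.sub_le_sub (EReal.coe_le_coe_iff.2 (le_of_eq ?_))
      (EReal.coe_ennreal_le_coe_ennreal_iff.2 ?_)
    · refine Finset.sum_congr rfl fun π _ => ?_
      congr 1
      rw [← Finset.sum_fiberwise_of_maps_to hmaps]
      refine Finset.sum_congr rfl fun φ hφ => ?_
      have h1 := sum_mixture_smul hΦ α hb hu0 (fun x => x.1.value x.2 - x.1.value π) φ hφ
      simp only [NNReal.smul_def, smul_eq_mul] at h1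
      rw [h1]
      refine Finset.sum_congr rfl fun i _ => ?_
      simp only [mul_sub, Finset.sum_sub_distrib]
      rw [husup, huval]
    · refine Finset.sum_le_sum fun π _ => ?_
      gcongr
      calc ∑ φ ∈ Φ, klDiv (blockMeasure ν φ π)
              ((if φ ∈ Φ then n φ else 0) • ∑ φ' ∈ Φ, blockMeasure ν φ' π)
          = ∑ φ ∈ Φ, klDiv (blockMeasure ν φ π) (n φ • ∑ φ' ∈ Φ, blockMeasure ν φ' π) :=
            Finset.sum_congr rfl fun φ hφ => by rw [if_pos hφ]
        _ ≤ ∑ φ ∈ Φ, klDiv (blockMeasure ν φ π) (n φ • (Mbar.law π : Measure O)) :=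
            sum_klDiv_mixture_le Φ n hnsum _ _
        _ ≤ ∑ φ ∈ Φ, ∑ i with b i = φ, (α i : ℝ≥0∞) *
              klDiv ((M i).law π : Measure O) (Mbar.law π : Measure O) := by
            refine Finset.sum_le_sum fun φ hφ => ?_
            -- `n φ` is the sum of the `α i` over the block, so numerator and reference split along
            -- the same index set.
            rw [hblock φ hφ, Finset.sum_smul]
            refine (klDiv_sum_le _ _ _).trans (le_of_eq ?_)
            exact Finset.sum_congr rfl fun i _ => klDiv_smul_same _
        _ = _ := Finset.sum_fiberwise_of_maps_to hmaps _

lemma coe_sub_coe_ennreal_of_ne_top (a : ℝ) {k : ℝ≥0∞} (hk : k ≠ ∞) :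
    (a : EReal) - (k : EReal) = ((a - k.toReal : ℝ) : EReal) := by
  lift k to ℝ≥0 using hk
  rfl

/-- The DEC is at most the max-min value of `AIR`. -/
lemma DEC_le_maxMinAIR {ℳ : Finset (Model P O)} {Θ : Finset (Finset (Model P O))}
    (hΘ : (Θ : Set (Finset (Model P O))).PairwiseDisjoint id) {η : ℝ} (hη : 0 < η) :
    DEC η (convexification ℳ (prodPolicies (P := P) Θ)) ≤ maxMinAIR η (prodPolicies Θ) := by
  classical
  set Φ := prodPolicies (P := P) Θ with hΦdef
  set S := convexification ℳ Φ with hS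
  refine iSup₂_le fun Mbar _ => le_of_forall_gt_imp_ge_of_dense fun c hc => ?_
  -- The level `c₁` is used for the separation; the gap up to `c₂` pays for the uniform admixture.
  obtain ⟨c₁, hc₁, hc₁c⟩ := EReal.lt_iff_exists_real_btwn.1 hc
  obtain ⟨c₂, hc₂, hc₂c⟩ := EReal.lt_iff_exists_real_btwn.1 hc₁c
  have hc₁₂ : c₁ < c₂ := EReal.coe_lt_coe_iff.1 hc₂
  let kl : Model P O → P → ℝ≥0∞ := fun M π =>
    klDiv (M.law π : Measure O) (Mbar.law π : Measure O)
  let e : ℝ≥0∞ := ENNReal.ofReal (1 / η)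
  have he0 : e ≠ 0 := by simpa [e] using hη
  have he : e ≠ ∞ := ENNReal.ofReal_ne_top
  let v : Model P O → P → ℝ := fun M π =>
    ((⨆ π', M.value π') - M.value π) - e.toReal * (kl M π).toReal
  -- Only models at finite divergence give real vectors, as the separation requires.
  let A : Set (P → ℝ) := v '' {M | M ∈ S ∧ ∀ π, kl M π ≠ ∞}
  have hhull : ∀ z ∈ convexHull ℝ A, ∃ π, z π ≤ c₁ := by
    intro z hz
    obtain ⟨ι, _, w, y, hw0, hw1, hy, rfl⟩ := mem_convexHull_iff_exists_fintype.1 hz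
    choose M hM hMy using hy
    let α : ι → ℝ≥0 := fun i => (w i).toNNReal
    have hαw : ∀ i, (α i : ℝ) = w i := fun i => Real.coe_toNNReal _ (hw0 i)
    have hα : ∑ i, α i = 1 := by
      rw [← NNReal.coe_inj]
      push_cast
      simpa only [hαw] using hw1
    obtain ⟨ρ, hρ, ν, hν, hge⟩ := exists_AIR_ge hΘ hη α hα M (fun i => (hM i).1) Mbar
    have hlt : ⨅ p ∈ simplex (Finset.univ : Finset P), AIR Φ ρ η p ν < c₁ := by
      refine lt_of_le_of_lt ?_ hc₁
      exact le_iSup₂_of_le (f := fun ρ (_ : ρ ∈ simplex Φ) => ⨆ ν ∈ simplex (support Φ),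
        ⨅ p ∈ simplex (Finset.univ : Finset P), AIR Φ ρ η p ν) ρ hρ
        (le_iSup₂ (f := fun ν (_ : ν ∈ simplex (support Φ)) =>
          ⨅ p ∈ simplex (Finset.univ : Finset P), AIR Φ ρ η p ν) ν hν)
    simp only [iInf_lt_iff] at hlt
    obtain ⟨p, hp, hlt⟩ := hlt
    have hlt' := (hge p).trans_lt hlt
    have hfin : ∀ π, ∑ i, (α i : ℝ≥0∞) * kl (M i) π ≠ ∞ := fun π =>
      ENNReal.sum_ne_top.2 fun i _ => ENNReal.mul_ne_top ENNReal.coe_ne_top ((hM i).2 π)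
    rw [coe_sub_coe_ennreal_of_ne_top _ (ENNReal.sum_ne_top.2 fun π _ =>
      ENNReal.mul_ne_top ENNReal.coe_ne_top (ENNReal.mul_ne_top he (hfin π))),
      EReal.coe_lt_coe_iff, ENNReal.toReal_sum fun π _ =>
      ENNReal.mul_ne_top ENNReal.coe_ne_top (ENNReal.mul_ne_top he (hfin π)),
      ← Finset.sum_sub_distrib] at hlt'
    have hz : ∀ π, (∑ i, w i • y i) π =
        ∑ i, (α i : ℝ) * ((⨆ π', (M i).value π') - (M i).value π) -
          (e * ∑ i, (α i : ℝ≥0∞) * kl (M i) π).toReal := by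
      intro π
      rw [ENNReal.toReal_mul, ENNReal.toReal_sum fun i _ =>
        ENNReal.mul_ne_top ENNReal.coe_ne_top ((hM i).2 π), Finset.mul_sum,
        ← Finset.sum_sub_distrib, Finset.sum_apply]
      refine Finset.sum_congr rfl fun i _ => ?_
      rw [Pi.smul_apply, smul_eq_mul, ← hMy i, ENNReal.toReal_mul, ENNReal.coe_toReal, ← hαw]
      simp only [v]
      ring
    -- If every coordinate exceeded `c₁`, so would every average, whereas the `p` found for this
    -- mixture has average below `c₁`.
    by_contra! hcon
    refine absurd hlt' (not_lt.2 ?_)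
    have hp1 : ∑ π, (p π : ℝ) = 1 := by exact_mod_cast hp.2
    calc c₁ = ∑ π, (p π : ℝ) * c₁ := by rw [← Finset.sum_mul, hp1, one_mul]
      _ ≤ ∑ π, (p π : ℝ) * (∑ i, w i • y i) π :=
          Finset.sum_le_sum fun π _ => mul_le_mul_of_nonneg_left (hcon π).le (p π).coe_nonneg
      _ = _ := by
          refine Finset.sum_congr rfl fun π _ => ?_
          rw [hz, ENNReal.toReal_mul (a := (p π : ℝ≥0∞)), ENNReal.coe_toReal, mul_sub]
  obtain ⟨p₀, hp₀, hp₀A⟩ := exists_simplex_sum_le A c₁ hhull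
  have hp₀1 : ∑ π, (p₀ π : ℝ) = 1 := by exact_mod_cast hp₀.2
  -- Mixing with the uniform distribution excludes the models at infinite divergence.
  obtain ⟨ε, δ, hε, hεδ, hle⟩ : ∃ ε δ : ℝ≥0, 0 < ε ∧ δ + ε = 1 ∧ δ * c₁ + ε ≤ c₂ := by
    have hD : 0 < (c₂ - c₁) + 1 + |c₁| := by
      have := abs_nonneg c₁
      linarith
    -- With `g = c₂ - c₁`, clearing the denominator in `δ * c₁ + ε ≤ c₂` leaves `0 ≤ g * (c₁ + |c₁|)
    -- + g ^ 2`.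
    refine ⟨((c₂ - c₁) / ((c₂ - c₁) + 1 + |c₁|)).toNNReal,
      ((1 + |c₁|) / ((c₂ - c₁) + 1 + |c₁|)).toNNReal, ?_, ?_, ?_⟩
    · exact Real.toNNReal_pos.2 (div_pos (by linarith) hD)
    · rw [← Real.toNNReal_add (by positivity) (div_nonneg (by linarith) hD.le), ← add_div,
        show 1 + |c₁| + (c₂ - c₁) = (c₂ - c₁) + 1 + |c₁| by ring, div_self hD.ne']
      simp
    · rw [Real.coe_toNNReal _ (by positivity),
        Real.coe_toNNReal _ (div_nonneg (by linarith) hD.le), div_mul_eq_mul_div, ← add_div,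
        div_le_iff₀ hD]
      nlinarith [le_abs_self c₁, neg_abs_le c₁]
  have hcard : ((Fintype.card P : ℝ≥0)) ≠ 0 := by
    exact_mod_cast Fintype.card_ne_zero
  let p : P → ℝ≥0 := fun π => δ * p₀ π + ε * (Fintype.card P : ℝ≥0)⁻¹
  have hppos : ∀ π, p π ≠ 0 := fun π => by
    have : 0 < p π := by positivity
    exact this.ne'
  have hp : p ∈ simplex (Finset.univ : Finset P) := by
    refine ⟨by simp, ?_⟩
    simp only [p]
    rw [Finset.sum_add_distrib, ← Finset.mul_sum, hp₀.2, Finset.sum_const, Finset.card_univ,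
      nsmul_eq_mul, mul_one, mul_left_comm, mul_inv_cancel₀ hcard, mul_one, hεδ]
  refine le_trans (iInf₂_le_of_le p hp (iSup₂_le fun M hM => ?_)) hc₂c.le
  rw [sum_regret_sub_klDiv_eq hη]
  by_cases hfin : ∀ π, kl M π ≠ ∞
  · have hne : ∀ π ∈ Finset.univ, (p π : ℝ≥0∞) * (e * kl M π) ≠ ∞ := fun π _ =>
      ENNReal.mul_ne_top ENNReal.coe_ne_top (ENNReal.mul_ne_top he (hfin π))
    rw [coe_sub_coe_ennreal_of_ne_top _ (ENNReal.sum_ne_top.2 hne), EReal.coe_le_coe_iff,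
      ENNReal.toReal_sum hne, ← Finset.sum_sub_distrib]
    have h1 := hp₀A (v M) ⟨M, ⟨hM, hfin⟩, rfl⟩
    have hv1 : ∀ π, v M π ≤ 1 := fun π => by
      have h2 : ⨆ π', M.value π' ≤ 1 := ciSup_le fun π' => (M.value_mem π').2
      have h3 := (M.value_mem π).1
      have h4 : 0 ≤ e.toReal * (kl M π).toReal := by positivity
      simp only [v]
      linarith
    have hcard' : (Fintype.card P : ℝ) ≠ 0 := by exact_mod_cast hcard
    calc _ = ∑ π, (p π : ℝ) * v M π := by
          refine Finset.sum_congr rfl fun π _ => ?_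
          rw [ENNReal.toReal_mul, ENNReal.toReal_mul, ENNReal.coe_toReal]
          simp only [v]
          ring
      _ = δ * ∑ π, (p₀ π : ℝ) * v M π + ε * (Fintype.card P : ℝ)⁻¹ * ∑ π, v M π := by
          rw [Finset.mul_sum, Finset.mul_sum, ← Finset.sum_add_distrib]
          refine Finset.sum_congr rfl fun π _ => ?_
          simp only [p]
          push_cast
          ring
      _ ≤ δ * c₁ + ε * (Fintype.card P : ℝ)⁻¹ * ∑ π : P, (1 : ℝ) := by
          gcongr with π
          exact hv1 π
      _ = δ * c₁ + ε := by
          rw [Finset.sum_const, Finset.card_univ, nsmul_eq_mul, mul_one, mul_assoc,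
            inv_mul_cancel₀ hcard', mul_one]
      _ ≤ c₂ := hle
  · push Not at hfin
    obtain ⟨π, hπ⟩ := hfin
    have : ∑ π, (p π : ℝ≥0∞) * (e * kl M π) = ∞ := by
      refine ENNReal.sum_eq_top.2 ⟨π, Finset.mem_univ π, ?_⟩
      rw [hπ, ENNReal.mul_top he0, ENNReal.mul_top (by exact_mod_cast hppos π)]
    rw [this]
    simp

end

end DecisionMaking

end

theorem lemma3 {P O : Type*} [Fintype P] [Nonempty P] [MeasurableSpace O]
    [DecidableEq (DecisionMaking.Model P O)]
    (ℳ : Finset (DecisionMaking.Model P O)) (Θ : Finpartition ℳ) (η : ℝ) (hη : 0 < η) :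
    DecisionMaking.maxMinAIR η (DecisionMaking.prodPolicies Θ.parts) =
      DecisionMaking.DEC η
        (DecisionMaking.convexification ℳ (DecisionMaking.prodPolicies Θ.parts)) := by
  have hΘ : (Θ.parts : Set (Finset (DecisionMaking.Model P O))).PairwiseDisjoint id :=
    Θ.disjoint
  exact le_antisymm (DecisionMaking.maxMinAIR_le_DEC hΘ (fun θ hθ => Θ.le hθ) hη)
    (DecisionMaking.DEC_le_maxMinAIR hΘ hη)
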